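/- Let $\mathcal P$ be a probability distribution on $\mathbb R^d$ such that $\|Y\|\le 1$ almost surely for $Y\sim\mathcal P$ (Euclidean norm). Let $\Sigma=\mathbb E_{Y\sim\mathcal P}[YY^\top]$ be its second-moment matrix and let $\rho^2=\sigma_1(\Sigma)$, where $\sigma_1(\cdot)$ denotes the largest singular value of a matrix. Let $Y_1,\dots,Y_K$ be an i.i.d. sample from $\mathcal P$ and set $Q_K=\sum_{k=1}^K Y_kY_k^\top$. (If $\rho=0$, the fractions with denominator $3\rho^2$ below are read as $0$.) If $K>\frac{4}{3\rho^2}\log d$, then $$\mathbb E\left[\frac{\sigma_1(Q_K)}{K}\right]\le 5\rho^2 .$$ If $K>\max\left\{\frac{4}{3\rho^2}\log d,\ \frac{8\sqrt2}{3\rho^2}\sqrt d\right\}$, then $$\mathbb E\left[\frac{\sigma_1(Q_K)^2}{K^2}\right]\le 14\rho^4 .$$ -/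

import Mathlib

open MeasureTheory ProbabilityTheory

namespace SampledGram

/-- The largest singular value `σ₁(A)` of a real `d × d` matrix, i.e. the first of the (zero-indexed,
decreasingly ordered) singular values of `A` acting on Euclidean space; it is `0` if `d = 0`. -/
noncomputable def sigmaOne {d : ℕ} (A : Matrix (Fin d) (Fin d) ℝ) : ℝ :=
  (Matrix.toEuclideanLin A).singularValues 0

/-- The rank-one matrix `y yᵀ`. -/
def outer {d : ℕ} (y : EuclideanSpace ℝ (Fin d)) : Matrix (Fin d) (Fin d) ℝ :=
  Matrix.of fun i j => y i * y j

/-- The second moment matrix `𝔼_{Y ∼ P}[Y Yᵀ]` of a distribution `P` on `ℝᵈ`; the expectation of a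
random matrix is taken entrywise. -/
noncomputable def secondMoment {d : ℕ} (P : Measure (EuclideanSpace ℝ (Fin d))) :
    Matrix (Fin d) (Fin d) ℝ :=
  Matrix.of fun i j => ∫ y, outer y i j ∂P

/-- The matrix `Q_K = ∑ₖ Yₖ Yₖᵀ` of a sample `Y₁, …, Y_K` (a random matrix, evaluated at `ω`). -/
def sampleMatrix {d K : ℕ} {Ω : Type*} (Y : Fin K → Ω → EuclideanSpace ℝ (Fin d)) (ω : Ω) :
    Matrix (Fin d) (Fin d) ℝ :=
  ∑ k, outer (Y k ω)

end SampledGram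

/-! ### Matrix analysis: singular values, quadratic forms of powers, traces. -/

namespace SampledGram

open Matrix
open scoped Matrix.Norms.L2Operator

/-! The trace moments of `Q = ∑ Yₖ Yₖᵀ` are compared with Poisson moments. Write `tr Q^(p+1) = ∑ₖ
Yₖᵀ Q^p Yₖ` and let `Q₋ₖ` be `Q` without its `k`-th term. Since `‖Yₖ‖ ≤ 1`, each summand is at most
`Yₖᵀ (Q₋ₖ + 1)^p Yₖ` (`dotProduct_pow_add_vecMulVec_le`). As `Yₖ` is independent of `Q₋ₖ`, averaging
replaces `Yₖ Yₖᵀ` by `Σ`, and `Σ` costs at most a factor `ρ²` under the trace. Expanding `(Q₋ₖ +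
1)^p` gives the recursion satisfied by the moments of a Poisson variable of mean `x = Kρ²`, so `𝔼 tr
Q^p` is at most `d` times the `p`-th such moment (`integral_trace_gramSum_pow_le`).

Since `σ₁(Q)^p ≤ tr Q^p`, summing over `p` with weights `1/p!` gives `𝔼 exp σ₁(Q) ≤ d exp((e -
1)x)`. The lower bound on `K` absorbs `d` and leaves `exp(5x/2)`. Convexity of `exp` then bounds the
first moment by `5x/2`, and a pointwise comparison with `exp` bounds the second by `a² + 2a + 2`,
where `a = 5x/2`. -/

theorem norm_eq_singularValues_zero {E F : Type*} [NormedAddCommGroup E] [InnerProductSpace ℝ E]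
    [FiniteDimensional ℝ E] [NormedAddCommGroup F] [InnerProductSpace ℝ F] [FiniteDimensional ℝ F]
    (T : E →ₗ[ℝ] F) : T.singularValues 0 = ‖LinearMap.toContinuousLinearMap T‖ := by
  rcases Nat.eq_zero_or_pos (Module.finrank ℝ E) with h0 | h0
  · rw [T.singularValues_of_finrank_le h0.le]
    have : Subsingleton E := Module.finrank_zero_iff.mp h0
    rw [Subsingleton.elim (LinearMap.toContinuousLinearMap T) 0, norm_zero]
  set hT := T.isSymmetric_adjoint_comp_self
  set b := hT.eigenvectorBasis rfl
  have hsq := T.sq_singularValues_of_lt rfl h0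
  -- In an eigenbasis of `T* T` the form `‖T x‖²` is diagonal, and index `0` carries the largest
  -- eigenvalue.
  have key : ∀ x, ‖T x‖ ^ 2 = ∑ i, hT.eigenvalues rfl i * inner ℝ (b i) x ^ 2 := by
    intro x
    have h1 : ‖T x‖ ^ 2 = inner ℝ ((T.adjoint ∘ₗ T) x) x := by
      rw [LinearMap.comp_apply, LinearMap.adjoint_inner_left, real_inner_self_eq_norm_sq]
    rw [h1, ← b.sum_inner_mul_inner]
    refine Finset.sum_congr rfl fun i _ => ?_
    rw [hT x (b i), hT.apply_eigenvectorBasis rfl i, inner_smul_right, real_inner_comm]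
    simp [sq, mul_assoc, b]
  refine le_antisymm ?_ ?_
  · refine le_of_sq_le_sq ?_ (norm_nonneg _)
    have h1 : ‖T (b ⟨0, h0⟩)‖ ^ 2 = hT.eigenvalues rfl ⟨0, h0⟩ := by
      rw [key, Finset.sum_eq_single ⟨0, h0⟩]
      · simp
      · intro i _ hi
        simp [b.inner_eq_zero hi]
      · simp
    rw [hsq, ← h1]
    have := (LinearMap.toContinuousLinearMap T).le_opNorm (b ⟨0, h0⟩)
    simp only [b.norm_eq_one, mul_one] at this
    exact pow_le_pow_left₀ (norm_nonneg _) this 2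
  · refine ContinuousLinearMap.opNorm_le_bound _ (T.singularValues_nonneg 0) fun x => ?_
    refine le_of_sq_le_sq ?_ (mul_nonneg (T.singularValues_nonneg 0) (norm_nonneg _))
    change ‖T x‖ ^ 2 ≤ _
    rw [key, mul_pow, hsq, ← b.sum_sq_inner_right x, Finset.mul_sum]
    refine Finset.sum_le_sum fun i _ => ?_
    exact mul_le_mul_of_nonneg_right (hT.eigenvalues_antitone rfl (Nat.zero_le _)) (sq_nonneg _)

theorem sigmaOne_eq_norm {d : ℕ} (A : Matrix (Fin d) (Fin d) ℝ) : sigmaOne A = ‖A‖ := by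
  rw [sigmaOne, norm_eq_singularValues_zero, l2_opNorm_def]
  rfl

variable {n : Type*} [Fintype n] [DecidableEq n]

theorem PosSemidef.exists_diagonalization {A : Matrix n n ℝ} (hA : A.PosSemidef) :
    ∃ (U : unitaryGroup n ℝ) (l : n → ℝ), (∀ i, 0 ≤ l i) ∧
      A = (U : Matrix n n ℝ) * diagonal l * star (U : Matrix n n ℝ) := by
  refine ⟨hA.1.eigenvectorUnitary, hA.1.eigenvalues, hA.eigenvalues_nonneg, ?_⟩
  conv_lhs => rw [hA.1.spectral_theorem]
  simp [Unitary.conjStarAlgAut_apply]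

theorem conj_diagonal_pow (U : unitaryGroup n ℝ) (l : n → ℝ) (p : ℕ) :
    ((U : Matrix n n ℝ) * diagonal l * star (U : Matrix n n ℝ)) ^ p
      = (U : Matrix n n ℝ) * diagonal (fun i => l i ^ p) * star (U : Matrix n n ℝ) := by
  have h := map_pow (Unitary.conjStarAlgAut ℝ (Matrix n n ℝ) U) (diagonal l) p
  rw [diagonal_pow] at h
  simp only [Unitary.conjStarAlgAut_apply] at h
  exact h.symm

theorem conj_diagonal_add_one (U : unitaryGroup n ℝ) (l : n → ℝ) :
    (U : Matrix n n ℝ) * diagonal l * star (U : Matrix n n ℝ) + 1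
      = (U : Matrix n n ℝ) * diagonal (fun i => l i + 1) * star (U : Matrix n n ℝ) := by
  have h := map_add (Unitary.conjStarAlgAut ℝ (Matrix n n ℝ) U) (diagonal l) 1
  rw [map_one, ← diagonal_one, diagonal_add] at h
  simpa [Unitary.conjStarAlgAut_apply] using h.symm

theorem dotProduct_conj_diagonal_mulVec (U : Matrix n n ℝ) (l y : n → ℝ) :
    y ⬝ᵥ (U * diagonal l * star U) *ᵥ y = ∑ i, l i * ((star U) *ᵥ y) i ^ 2 := by
  rw [← mulVec_mulVec, ← mulVec_mulVec, dotProduct_mulVec, dotProduct]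
  refine Finset.sum_congr rfl fun i _ => ?_
  have : (y ᵥ* U) i = (star U *ᵥ y) i := by
    rw [star_eq_conjTranspose, conjTranspose_eq_transpose_of_trivial, mulVec_transpose]
  rw [this, mulVec_diagonal]
  ring

theorem dotProduct_star_mulVec_self (U : unitaryGroup n ℝ) (y : n → ℝ) :
    ∑ i, ((star (U : Matrix n n ℝ)) *ᵥ y) i ^ 2 = ∑ i, y i ^ 2 := by
  have h := dotProduct_conj_diagonal_mulVec (U : Matrix n n ℝ) (fun _ => 1) y
  simp only [diagonal_one, mul_one, one_mul] at h
  rw [← h, mem_unitaryGroup_iff.mp U.2, one_mulVec, dotProduct]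
  simp [sq]

/-- Chebyshev's sum inequality with weights of total mass at most one. -/
theorem sum_mul_sum_le_of_monovary {ι : Type*} [Fintype ι] {w f g : ι → ℝ} (hw : ∀ i, 0 ≤ w i)
    (hw1 : ∑ i, w i ≤ 1) (hf : ∀ i, 0 ≤ f i) (hg : ∀ i, 0 ≤ g i) (h : Monovary f g) :
    (∑ i, f i * w i) * (∑ i, g i * w i) ≤ ∑ i, f i * g i * w i := by
  -- Symmetrisation: this double sum is twice the gap in Chebyshev's inequality.
  have h1 : 0 ≤ ∑ i, ∑ j, w i * w j * ((f i - f j) * (g i - g j)) := by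
    refine Finset.sum_nonneg fun i _ => Finset.sum_nonneg fun j _ =>
      mul_nonneg (mul_nonneg (hw i) (hw j)) ?_
    exact monovary_iff_forall_mul_nonneg.mp h j i
  have h2 : ∑ i, ∑ j, w i * w j * ((f i - f j) * (g i - g j))
      = 2 * ((∑ i, w i) * ∑ i, f i * g i * w i) - 2 * ((∑ i, f i * w i) * ∑ i, g i * w i) := by
    have e1 : (∑ i, w i) * (∑ i, f i * g i * w i) = ∑ i, ∑ j, w i * (f j * g j * w j) := by
      rw [Finset.sum_mul_sum]
    have e2 : (∑ i, w i) * (∑ i, f i * g i * w i) = ∑ i, ∑ j, w j * (f i * g i * w i) := by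
      rw [e1, Finset.sum_comm]
    have e3 : (∑ i, f i * w i) * (∑ i, g i * w i) = ∑ i, ∑ j, (f i * w i) * (g j * w j) := by
      rw [Finset.sum_mul_sum]
    have e4 : (∑ i, f i * w i) * (∑ i, g i * w i) = ∑ i, ∑ j, (f j * w j) * (g i * w i) := by
      rw [e3, Finset.sum_comm]
    rw [two_mul, two_mul]
    nth_rewrite 1 [e1]
    nth_rewrite 1 [e3]
    rw [e2, e4]
    simp only [← Finset.sum_add_distrib, ← Finset.sum_sub_distrib]
    refine Finset.sum_congr rfl fun i _ => Finset.sum_congr rfl fun j _ => by ring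
  have h3 : (∑ i, w i) * (∑ i, f i * g i * w i) ≤ 1 * ∑ i, f i * g i * w i :=
    mul_le_mul_of_nonneg_right hw1
      (Finset.sum_nonneg fun i _ => mul_nonneg (mul_nonneg (hf i) (hg i)) (hw i))
  linarith

/-- Each word in `(a + b)^m` other than `a^m` is sorted by the position `j` of its first `b`; no
commutativity is needed. It is used with `b = y yᵀ` for matrices, and with `b = 1` for eigenvalues.
-/
theorem add_pow_eq_pow_add_sum {R : Type*} [Ring R] (a b : R) (m : ℕ) :
    (a + b) ^ m = a ^ m + ∑ j ∈ Finset.range m, a ^ j * b * (a + b) ^ (m - 1 - j) := by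
  induction m with
  | zero => simp
  | succ m ih =>
    rw [pow_succ', add_mul]
    nth_rewrite 1 [ih]
    rw [Finset.sum_range_succ', mul_add, Finset.mul_sum, ← pow_succ']
    simp only [pow_zero, one_mul, Nat.sub_zero, Nat.add_sub_cancel, ← add_assoc]
    congr 2
    refine Finset.sum_congr rfl fun j hj => ?_
    rw [Nat.sub_sub, add_comm 1 j, pow_succ']
    simp [mul_assoc]

/-- In the first-occurrence expansion the rank-one factor splits each term into a product of two
quadratic forms. Induction bounds the second form. Both are then integrals of increasing functions
against the spectral measure `w` of `y`, of mass at most one, so Chebyshev merges them into one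
integral, and the same expansion with `b = 1` resums the result. -/
theorem dotProduct_pow_add_vecMulVec_le {A : Matrix n n ℝ} (hA : A.PosSemidef) (y : n → ℝ)
    (hy : ∑ i, y i ^ 2 ≤ 1) (m : ℕ) :
    y ⬝ᵥ ((A + vecMulVec y y) ^ m) *ᵥ y ≤ y ⬝ᵥ ((A + 1) ^ m) *ᵥ y := by
  obtain ⟨U, l, hl, rfl⟩ := PosSemidef.exists_diagonalization hA
  set V : Matrix n n ℝ := (U : Matrix n n ℝ) * diagonal l * star (U : Matrix n n ℝ) with hV
  set w : n → ℝ := fun i => ((star (U : Matrix n n ℝ)) *ᵥ y) i ^ 2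
  have hpow : ∀ j, y ⬝ᵥ (V ^ j) *ᵥ y = ∑ i, l i ^ j * w i := fun j => by
    rw [hV, conj_diagonal_pow, dotProduct_conj_diagonal_mulVec]
  have hpow1 : ∀ j, y ⬝ᵥ ((V + 1) ^ j) *ᵥ y = ∑ i, (l i + 1) ^ j * w i := fun j => by
    rw [hV, conj_diagonal_add_one, conj_diagonal_pow, dotProduct_conj_diagonal_mulVec]
  have hw1 : ∑ i, w i ≤ 1 := (dotProduct_star_mulVec_self U y).trans_le hy
  induction m using Nat.strong_induction_on with
  | _ m ih =>
    have hrec : y ⬝ᵥ ((V + vecMulVec y y) ^ m) *ᵥ y = y ⬝ᵥ (V ^ m) *ᵥ y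
        + ∑ j ∈ Finset.range m, (y ⬝ᵥ (V ^ j) *ᵥ y)
          * (y ⬝ᵥ ((V + vecMulVec y y) ^ (m - 1 - j)) *ᵥ y) := by
      rw [add_pow_eq_pow_add_sum, add_mulVec, dotProduct_add, sum_mulVec, dotProduct_sum]
      congr 1
      refine Finset.sum_congr rfl fun j _ => ?_
      rw [← mulVec_mulVec, ← mulVec_mulVec, vecMulVec_mulVec]
      simp [mulVec_smul, mul_comm]
    rw [hrec, hpow1, hpow]
    have hstep : ∀ j ∈ Finset.range m, (y ⬝ᵥ (V ^ j) *ᵥ y)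
          * (y ⬝ᵥ ((V + vecMulVec y y) ^ (m - 1 - j)) *ᵥ y)
          ≤ ∑ i, l i ^ j * (l i + 1) ^ (m - 1 - j) * w i := by
      intro j hj
      have hj' := Finset.mem_range.mp hj
      have h1 := ih (m - 1 - j) (by omega)
      have h0 : 0 ≤ y ⬝ᵥ (V ^ j) *ᵥ y := by
        rw [hpow]
        exact Finset.sum_nonneg fun i _ => mul_nonneg (pow_nonneg (hl i) _) (sq_nonneg _)
      refine (mul_le_mul_of_nonneg_left h1 h0).trans ?_
      rw [hpow, hpow1]
      refine sum_mul_sum_le_of_monovary (fun i => sq_nonneg _) hw1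
        (fun i => pow_nonneg (hl i) _) (fun i => pow_nonneg (by linarith [hl i]) _) ?_
      intro a b hab
      have hlt : l a + 1 < l b + 1 := lt_of_pow_lt_pow_left₀ _ (by linarith [hl b]) hab
      exact pow_le_pow_left₀ (hl a) (by linarith) _
    have hsum := Finset.sum_le_sum hstep
    refine (add_le_add_right hsum _).trans_eq ?_
    rw [Finset.sum_comm, ← Finset.sum_add_distrib]
    refine Finset.sum_congr rfl fun i _ => ?_
    -- The expansion is now read backwards, one eigenvalue at a time.
    rw [add_pow_eq_pow_add_sum (l i) 1 m, add_mul, Finset.sum_mul]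
    simp

theorem norm_pow_le_trace_pow [Nonempty n] {A : Matrix n n ℝ} (hA : A.PosSemidef) (p : ℕ) :
    ‖A‖ ^ p ≤ (A ^ p).trace := by
  obtain ⟨U, l, hl, rfl⟩ := PosSemidef.exists_diagonalization hA
  rw [conj_diagonal_pow, trace_mul_cycle, mem_unitaryGroup_iff'.mp U.2, one_mul,
    trace_diagonal, ← Unitary.coe_star, CStarRing.norm_mul_coe_unitary,
    CStarRing.norm_coe_unitary_mul, l2_opNorm_diagonal]
  obtain ⟨i, hi⟩ := Finite.exists_max l
  have : ‖l‖ ≤ l i := (pi_norm_le_iff_of_nonneg (hl i)).mpr fun j => by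
    rw [Real.norm_of_nonneg (hl j)]; exact hi j
  exact (pow_le_pow_left₀ (norm_nonneg _) this p).trans
    (Finset.single_le_sum (f := fun i => l i ^ p) (fun j _ => pow_nonneg (hl j) p)
      (Finset.mem_univ i))

theorem dotProduct_mulVec_le_norm (A : Matrix n n ℝ) (y : n → ℝ) :
    y ⬝ᵥ A *ᵥ y ≤ ‖A‖ * (y ⬝ᵥ y) := by
  have h1 := real_inner_le_norm (WithLp.toLp 2 (A *ᵥ y)) (WithLp.toLp 2 y)
  have h2 := l2_opNorm_mulVec A (WithLp.toLp 2 y)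
  have h3 : y ⬝ᵥ y = ‖WithLp.toLp 2 y‖ ^ 2 := by
    rw [← real_inner_self_eq_norm_sq, EuclideanSpace.inner_toLp_toLp]
    simp
  rw [EuclideanSpace.inner_toLp_toLp] at h1
  simp only [star_trivial] at h1
  refine h1.trans ((mul_le_mul_of_nonneg_right h2 (norm_nonneg _)).trans_eq ?_)
  rw [h3]
  ring

/-- Both `‖S‖ • 1 - S` and `B` are positive semidefinite, so their product has nonnegative trace, as
diagonalising `B` shows. -/
theorem trace_mul_le_norm_mul_trace {S B : Matrix n n ℝ} (hS : S.IsHermitian)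
    (hB : B.PosSemidef) : (S * B).trace ≤ ‖S‖ * B.trace := by
  have hN : (‖S‖ • (1 : Matrix n n ℝ) - S).PosSemidef := by
    refine PosSemidef.of_dotProduct_mulVec_nonneg ?_ fun y => ?_
    · refine IsHermitian.sub ?_ hS
      simp [IsHermitian]
    · have := dotProduct_mulVec_le_norm S y
      simp only [star_trivial, sub_mulVec, smul_mulVec, one_mulVec, dotProduct_sub,
        dotProduct_smul, smul_eq_mul]
      linarith
  have hNB : 0 ≤ ((‖S‖ • (1 : Matrix n n ℝ) - S) * B).trace := by
    obtain ⟨U, l, hl, rfl⟩ := PosSemidef.exists_diagonalization hB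
    rw [← mul_assoc, trace_mul_comm, ← mul_assoc, ← mul_assoc, trace]
    simp only [diag_apply, mul_diagonal]
    exact Finset.sum_nonneg fun i _ =>
      mul_nonneg (hN.conjTranspose_mul_mul_same (U : Matrix n n ℝ)).diag_nonneg (hl i)
  rw [sub_mul, trace_sub, smul_mul_assoc, one_mul, trace_smul, smul_eq_mul] at hNB
  linarith

end SampledGram

/-! ### Moments of the Poisson distribution. -/

namespace SampledGram

open scoped Nat

/-- The `p`-th moment `e⁻ˣ ∑ₘ mᵖ xᵐ / m!` of the Poisson distribution with mean `x`. -/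
noncomputable def poissonMoment (p : ℕ) (x : ℝ) : ℝ :=
  Real.exp (-x) * ∑' m : ℕ, (m : ℝ) ^ p * (x ^ m / m !)

theorem summable_pow_mul_pow_div_factorial (p : ℕ) {x : ℝ} (hx : 0 ≤ x) :
    Summable fun m : ℕ => (m : ℝ) ^ p * (x ^ m / m !) := by
  refine Summable.of_nonneg_of_le (fun m => by positivity) (fun m => ?_)
    ((Real.summable_pow_div_factorial (Real.exp 1 * x)).mul_left (p ! : ℝ))
  have h := Real.pow_div_factorial_le_exp (m : ℝ) (Nat.cast_nonneg m) p
  rw [div_le_iff₀ (by positivity)] at h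
  calc (m : ℝ) ^ p * (x ^ m / m !) ≤ (Real.exp m * p !) * (x ^ m / m !) := by gcongr
    _ = _ := by rw [← Real.exp_one_pow m, mul_pow]; ring

theorem poissonMoment_zero (x : ℝ) : poissonMoment 0 x = 1 := by
  have h : ∑' m : ℕ, ((m : ℝ) ^ 0 * (x ^ m / m !)) = Real.exp x := by
    simp only [pow_zero, one_mul, Real.exp_eq_exp_ℝ, NormedSpace.exp_eq_tsum_div]
  rw [poissonMoment, h, ← Real.exp_add]
  simp

/-- Absorbing one factor `m` into `m!` shifts the index, giving `𝔼 N^(p+1) = x 𝔼 (N + 1)^p`; then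
expand binomially. -/
theorem poissonMoment_succ (p : ℕ) {x : ℝ} (hx : 0 ≤ x) :
    poissonMoment (p + 1) x
      = x * ∑ j ∈ Finset.range (p + 1), (p.choose j : ℝ) * poissonMoment j x := by
  have h1 : ∑' m : ℕ, ((m : ℝ) ^ (p + 1) * (x ^ m / m !))
      = x * ∑' m : ℕ, ((m : ℝ) + 1) ^ p * (x ^ m / m !) := by
    rw [(summable_pow_mul_pow_div_factorial (p + 1) hx).tsum_eq_zero_add, ← tsum_mul_left]
    simp only [Nat.cast_zero, ne_eq, Nat.add_eq_zero_iff, one_ne_zero, and_false,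
      not_false_eq_true, zero_pow, zero_mul, zero_add]
    refine tsum_congr fun m => ?_
    rw [Nat.factorial_succ]
    push_cast
    have : (m ! : ℝ) ≠ 0 := by positivity
    have : (m : ℝ) + 1 ≠ 0 := by positivity
    field_simp
    ring
  have h2 : ∑' m : ℕ, ((m : ℝ) + 1) ^ p * (x ^ m / m !)
      = ∑ j ∈ Finset.range (p + 1), (p.choose j : ℝ) * ∑' m : ℕ, (m : ℝ) ^ j * (x ^ m / m !) := by
    simp only [← tsum_mul_left]
    rw [← Summable.tsum_finsetSum
      fun j _ => (summable_pow_mul_pow_div_factorial j hx).mul_left _]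
    refine tsum_congr fun m => ?_
    rw [add_pow, Finset.sum_mul]
    refine Finset.sum_congr rfl fun j _ => ?_
    simp only [one_pow, mul_one]
    ring
  rw [poissonMoment, h1, h2]
  simp only [poissonMoment, Finset.mul_sum]
  refine Finset.sum_congr rfl fun j _ => by ring

theorem poissonMoment_nonneg (p : ℕ) {x : ℝ} (hx : 0 ≤ x) : 0 ≤ poissonMoment p x :=
  mul_nonneg (Real.exp_pos _).le (tsum_nonneg fun m => by positivity)

/-- The factor `e⁻ˣ` hides monotonicity in the series; the recursion has nonnegative coefficients
and makes it evident. -/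
theorem poissonMoment_mono (p : ℕ) {x y : ℝ} (hx : 0 ≤ x) (hxy : x ≤ y) :
    poissonMoment p x ≤ poissonMoment p y := by
  induction p using Nat.strong_induction_on with
  | _ p ih =>
    rcases p with _ | p
    · simp [poissonMoment_zero]
    · rw [poissonMoment_succ p hx, poissonMoment_succ p (hx.trans hxy)]
      refine mul_le_mul hxy (Finset.sum_le_sum fun j hj => ?_)
        (Finset.sum_nonneg fun j _ => mul_nonneg (Nat.cast_nonneg _) (poissonMoment_nonneg j hx))
        (hx.trans hxy)
      exact mul_le_mul_of_nonneg_left (ih j (Finset.mem_range.mp hj)) (Nat.cast_nonneg _)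

/-- The full series is the Poisson moment generating function at `1`, namely `exp((e - 1)x)`. -/
theorem sum_poissonMoment_div_factorial_le (N : ℕ) {x : ℝ} (hx : 0 ≤ x) :
    ∑ p ∈ Finset.range N, poissonMoment p x / p ! ≤ Real.exp ((Real.exp 1 - 1) * x) := by
  have h1 : ∑ p ∈ Finset.range N, poissonMoment p x / p !
      = Real.exp (-x) * ∑' m : ℕ, ∑ p ∈ Finset.range N, (m : ℝ) ^ p / p ! * (x ^ m / m !) := by
    rw [Summable.tsum_finsetSum, Finset.mul_sum]
    · refine Finset.sum_congr rfl fun p _ => ?_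
      rw [poissonMoment, mul_div_assoc, ← tsum_div_const]
      congr 1
      exact tsum_congr fun m => by ring
    · intro p _
      refine ((summable_pow_mul_pow_div_factorial p hx).div_const (p ! : ℝ)).congr fun m => ?_
      ring
  have hs : Summable fun m : ℕ => (Real.exp 1 * x) ^ m / m ! := Real.summable_pow_div_factorial _
  have hle : ∀ m : ℕ, ∑ p ∈ Finset.range N, (m : ℝ) ^ p / p ! * (x ^ m / m !)
      ≤ (Real.exp 1 * x) ^ m / m ! := by
    intro m
    rw [← Finset.sum_mul, mul_pow, Real.exp_one_pow, mul_div_assoc]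
    exact mul_le_mul_of_nonneg_right (Real.sum_le_exp_of_nonneg (Nat.cast_nonneg m) N)
      (by positivity)
  have h2 : ∑' m : ℕ, ∑ p ∈ Finset.range N, (m : ℝ) ^ p / p ! * (x ^ m / m !)
      ≤ Real.exp (Real.exp 1 * x) := by
    have he : Real.exp (Real.exp 1 * x) = ∑' m : ℕ, (Real.exp 1 * x) ^ m / m ! := by
      rw [congrFun Real.exp_eq_exp_ℝ (Real.exp 1 * x), NormedSpace.exp_eq_tsum_div]
    rw [he]
    exact Summable.tsum_le_tsum hle
      (Summable.of_nonneg_of_le (fun m => Finset.sum_nonneg fun p _ => by positivity) hle hs) hs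
  rw [h1]
  calc _ ≤ Real.exp (-x) * Real.exp (Real.exp 1 * x) := by gcongr
    _ = _ := by rw [← Real.exp_add]; ring_nf

end SampledGram

/-! ### Trace moments of the sample matrix, by leaving one sample out. -/

namespace SampledGram

open Matrix
open scoped Matrix.Norms.L2Operator

/-- The partial sum `∑ k ∈ S, Yₖ Yₖᵀ`. -/
def gramSum {d : ℕ} {ι : Type*} (Y : ι → EuclideanSpace ℝ (Fin d)) (S : Finset ι) :
    Matrix (Fin d) (Fin d) ℝ :=
  ∑ k ∈ S, outer (Y k)

theorem outer_eq_vecMulVec {d : ℕ} (y : EuclideanSpace ℝ (Fin d)) :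
    outer y = vecMulVec y.ofLp y.ofLp := rfl

theorem posSemidef_outer {d : ℕ} (y : EuclideanSpace ℝ (Fin d)) : (outer y).PosSemidef := by
  simpa [outer_eq_vecMulVec] using posSemidef_vecMulVec_self_star (R := ℝ) y.ofLp

theorem trace_outer_mul {d : ℕ} (y : EuclideanSpace ℝ (Fin d)) (B : Matrix (Fin d) (Fin d) ℝ) :
    (outer y * B).trace = y.ofLp ⬝ᵥ B *ᵥ y.ofLp := by
  rw [outer_eq_vecMulVec, vecMulVec_mul, trace_vecMulVec, dotProduct_comm, dotProduct_mulVec]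

section Deterministic

variable {d : ℕ} {ι : Type*} (Y : ι → EuclideanSpace ℝ (Fin d)) (S : Finset ι)

theorem posSemidef_gramSum : (gramSum Y S).PosSemidef :=
  posSemidef_sum S fun k _ => posSemidef_outer (Y k)

theorem trace_gramSum_pow_succ_le [DecidableEq ι] (hY : ∀ k ∈ S, ‖Y k‖ ≤ 1) (p : ℕ) :
    (gramSum Y S ^ (p + 1)).trace
      ≤ ∑ k ∈ S, (outer (Y k) * (gramSum Y (S.erase k) + 1) ^ p).trace := by
  rw [pow_succ']
  nth_rewrite 1 [gramSum]
  rw [Finset.sum_mul, trace_sum]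
  refine Finset.sum_le_sum fun k hk => ?_
  have hsplit : gramSum Y S = gramSum Y (S.erase k) + vecMulVec (Y k).ofLp (Y k).ofLp :=
    (Finset.sum_erase_add S _ hk).symm
  rw [trace_outer_mul, trace_outer_mul, hsplit]
  refine dotProduct_pow_add_vecMulVec_le (posSemidef_gramSum Y _) _ ?_ p
  have h := EuclideanSpace.real_norm_sq_eq (Y k)
  rw [← h]
  exact pow_le_one₀ (norm_nonneg _) (hY k hk)

theorem trace_add_one_pow (A : Matrix (Fin d) (Fin d) ℝ) (p : ℕ) :
    ((A + 1) ^ p).trace = ∑ j ∈ Finset.range (p + 1), (p.choose j : ℝ) * (A ^ j).trace := by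
  rw [(Commute.one_right A).add_pow, trace_sum]
  refine Finset.sum_congr rfl fun j _ => ?_
  rw [one_pow, mul_one, ← Nat.cast_comm, ← nsmul_eq_mul, trace_smul, nsmul_eq_mul]

end Deterministic

section MemLp

variable {Ω : Type*} [MeasurableSpace Ω] {μ : Measure Ω} {d : ℕ}
  {M N : Ω → Matrix (Fin d) (Fin d) ℝ}

theorem memLp_top_mul_apply (hM : ∀ i j, MemLp (fun ω => M ω i j) ⊤ μ)
    (hN : ∀ i j, MemLp (fun ω => N ω i j) ⊤ μ) (i j : Fin d) :
    MemLp (fun ω => (M ω * N ω) i j) ⊤ μ := by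
  simp only [mul_apply]
  exact memLp_finsetSum _ fun k _ => (hN k j).mul' (hM i k)

theorem memLp_top_pow_apply [IsFiniteMeasure μ] (hM : ∀ i j, MemLp (fun ω => M ω i j) ⊤ μ) (p : ℕ)
    (i j : Fin d) : MemLp (fun ω => (M ω ^ p) i j) ⊤ μ := by
  induction p generalizing i j with
  | zero => simpa using memLp_const _
  | succ p ih =>
    simp only [pow_succ]
    exact memLp_top_mul_apply ih hM i j

theorem memLp_top_trace (hM : ∀ i j, MemLp (fun ω => M ω i j) ⊤ μ) :
    MemLp (fun ω => (M ω).trace) ⊤ μ :=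
  memLp_finsetSum _ fun i _ => hM i i

theorem integral_trace_mul (h : ∀ i j, Integrable (fun ω => M ω i j * N ω j i) μ) :
    ∫ ω, (M ω * N ω).trace ∂μ = ∑ i, ∑ j, ∫ ω, M ω i j * N ω j i ∂μ := by
  simp only [trace, diag_apply, mul_apply]
  rw [integral_finsetSum _ fun i _ => integrable_finsetSum _ fun j _ => h i j]
  exact Finset.sum_congr rfl fun i _ => integral_finsetSum _ fun j _ => h i j

end MemLp

section Random

variable {d : ℕ} {ι : Type*} {P : Measure (EuclideanSpace ℝ (Fin d))}
  {Ω : Type*} [MeasurableSpace Ω] {μ : Measure Ω}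
  {Y : ι → Ω → EuclideanSpace ℝ (Fin d)}

theorem measurable_outer_apply (i j : Fin d) :
    Measurable fun y : EuclideanSpace ℝ (Fin d) => outer y i j := by
  simp only [outer, of_apply]
  fun_prop

theorem memLp_top_outer_apply [IsFiniteMeasure μ] {X : Ω → EuclideanSpace ℝ (Fin d)}
    (hX : AEMeasurable X μ) (hX1 : ∀ᵐ ω ∂μ, ‖X ω‖ ≤ 1) (i j : Fin d) :
    MemLp (fun ω => outer (X ω) i j) ⊤ μ := by
  refine memLp_top_of_bound
    ((measurable_outer_apply i j).comp_aemeasurable hX).aestronglyMeasurable 1 ?_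
  filter_upwards [hX1] with ω hω
  simp only [outer, of_apply, norm_mul]
  exact mul_le_one₀ ((PiLp.norm_apply_le _ _).trans hω) (norm_nonneg _)
    ((PiLp.norm_apply_le _ _).trans hω)

theorem memLp_top_gramSum_apply [IsFiniteMeasure μ] (hY : ∀ k, AEMeasurable (Y k) μ)
    (hY1 : ∀ k, ∀ᵐ ω ∂μ, ‖Y k ω‖ ≤ 1) (S : Finset ι) (i j : Fin d) :
    MemLp (fun ω => gramSum (fun k => Y k ω) S i j) ⊤ μ := by
  simp only [gramSum, Matrix.sum_apply]
  exact memLp_finsetSum _ fun k _ => memLp_top_outer_apply (hY k) (hY1 k) i j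

theorem isHermitian_secondMoment : (secondMoment P).IsHermitian := by
  ext i j
  simp [secondMoment, outer, mul_comm]

theorem measurable_gramSum_pow_apply (S : Finset ι) (p : ℕ) (i j : Fin d) :
    Measurable fun y : S → EuclideanSpace ℝ (Fin d) =>
      ((gramSum y Finset.univ + 1) ^ p) i j := by
  refine Continuous.measurable ?_
  have h : Continuous fun y : S → EuclideanSpace ℝ (Fin d) => gramSum y Finset.univ := by
    refine continuous_finsetSum _ fun k _ => continuous_matrix fun a b => ?_
    simp only [outer, of_apply]
    fun_prop
  exact ((h.add continuous_const).pow p).matrix_elem i j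

theorem gramSum_univ_subtype (y : ι → EuclideanSpace ℝ (Fin d)) (S : Finset ι) :
    gramSum (fun k : S => y k) Finset.univ = gramSum y S :=
  Finset.sum_coe_sort S fun k => outer (y k)

theorem indepFun_outer_gramSum_pow [DecidableEq ι] (hindep : iIndepFun Y μ)
    (hY : ∀ k, AEMeasurable (Y k) μ) (S : Finset ι) (k : ι) (p : ℕ) (i j i' j' : Fin d) :
    IndepFun (fun ω => outer (Y k ω) i j)
      (fun ω => ((gramSum (fun l => Y l ω) (S.erase k) + 1) ^ p) i' j') μ := by
  have h := hindep.indepFun_finset₀ {k} (S.erase k) (by simp) hY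
  have hφ : Measurable fun y : ({k} : Finset ι) → EuclideanSpace ℝ (Fin d) =>
      outer (y ⟨k, Finset.mem_singleton_self k⟩) i j := by
    simp only [outer, of_apply]
    fun_prop
  have h' := h.comp hφ (measurable_gramSum_pow_apply (S.erase k) p i' j')
  convert! h' using 1
  funext ω
  simp only [Function.comp_apply]
  rw [gramSum_univ_subtype (fun l => Y l ω)]

variable [IsProbabilityMeasure μ]

theorem integral_trace_outer_mul_le [DecidableEq ι] (hindep : iIndepFun Y μ)
    (hlaw : ∀ k, HasLaw (Y k) P μ) (hY1 : ∀ k, ∀ᵐ ω ∂μ, ‖Y k ω‖ ≤ 1) (S : Finset ι) (k : ι)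
    (p : ℕ) :
    ∫ ω, (outer (Y k ω) * (gramSum (fun l => Y l ω) (S.erase k) + 1) ^ p).trace ∂μ
      ≤ ‖secondMoment P‖ * ∫ ω, ((gramSum (fun l => Y l ω) (S.erase k) + 1) ^ p).trace ∂μ := by
  have hY := fun k => (hlaw k).aemeasurable
  set B : Ω → Matrix (Fin d) (Fin d) ℝ :=
    fun ω => (gramSum (fun l => Y l ω) (S.erase k) + 1) ^ p
  have hB : ∀ i j, MemLp (fun ω => B ω i j) ⊤ μ := by
    refine memLp_top_pow_apply (fun i j => ?_) p
    exact (memLp_top_gramSum_apply hY hY1 _ i j).add (memLp_const ((1 : Matrix _ _ ℝ) i j))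
  have hO : ∀ i j, MemLp (fun ω => outer (Y k ω) i j) ⊤ μ :=
    memLp_top_outer_apply (hY k) (hY1 k)
  have hint : ∀ i j, Integrable (fun ω => B ω i j) μ := fun i j => (hB i j).integrable le_top
  -- `B` involves only the samples other than `Y k`, so the entrywise expectations factor.
  have h1 : ∫ ω, (outer (Y k ω) * B ω).trace ∂μ = ∫ ω, (secondMoment P * B ω).trace ∂μ := by
    rw [integral_trace_mul fun i j => ((hB j i).mul' (hO i j)).integrable le_top,
      integral_trace_mul (M := fun _ => secondMoment P) fun i j => (hint j i).const_mul _]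
    refine Finset.sum_congr rfl fun i _ => Finset.sum_congr rfl fun j _ => ?_
    rw [(indepFun_outer_gramSum_pow hindep hY S k p i j j i).integral_fun_mul_eq_mul_integral
      (hO i j).aestronglyMeasurable (hB j i).aestronglyMeasurable, integral_const_mul]
    congr 1
    exact (hlaw k).integral_comp (measurable_outer_apply i j).aestronglyMeasurable
  have hM : ∀ i j, MemLp (fun _ : Ω => secondMoment P i j) ⊤ μ := fun i j => memLp_const _
  have hSB := (memLp_top_trace (memLp_top_mul_apply hM hB)).integrable le_top
  have hB1 := ((memLp_top_trace hB).integrable le_top).const_mul ‖secondMoment P‖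
  rw [h1, ← integral_const_mul]
  refine integral_mono hSB hB1 fun ω => ?_
  exact trace_mul_le_norm_mul_trace isHermitian_secondMoment
      (((posSemidef_gramSum _ _).add PosSemidef.one).pow p)

theorem integrable_trace_gramSum_pow (hY : ∀ k, AEMeasurable (Y k) μ)
    (hY1 : ∀ k, ∀ᵐ ω ∂μ, ‖Y k ω‖ ≤ 1) (S : Finset ι) (p : ℕ) :
    Integrable (fun ω => (gramSum (fun k => Y k ω) S ^ p).trace) μ :=
  (memLp_top_trace (memLp_top_pow_apply (memLp_top_gramSum_apply hY hY1 S) p)).integrable le_top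

/-- The trace moments of a sum of independent `Yₖ Yₖᵀ` are at most `d` times Poisson moments. -/
theorem integral_trace_gramSum_pow_le (hindep : iIndepFun Y μ) (hlaw : ∀ k, HasLaw (Y k) P μ)
    (hY1 : ∀ k, ∀ᵐ ω ∂μ, ‖Y k ω‖ ≤ 1) (S : Finset ι) (p : ℕ) :
    ∫ ω, (gramSum (fun k => Y k ω) S ^ p).trace ∂μ
      ≤ d * poissonMoment p (S.card * ‖secondMoment P‖) := by
  classical
  have hY := fun k => (hlaw k).aemeasurable
  set r := ‖secondMoment P‖
  have hr : 0 ≤ r := norm_nonneg _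
  induction p using Nat.strong_induction_on generalizing S with
  | _ p ih =>
    rcases p with _ | p
    · simp [poissonMoment_zero]
    set x := S.card * r
    have hx : 0 ≤ x := by positivity
    have hstep : ∀ k ∈ S,
        ∫ ω, (outer (Y k ω) * (gramSum (fun l => Y l ω) (S.erase k) + 1) ^ p).trace ∂μ
          ≤ r * (d * ∑ j ∈ Finset.range (p + 1), (p.choose j : ℝ) * poissonMoment j x) := by
      intro k _
      refine (integral_trace_outer_mul_le hindep hlaw hY1 S k p).trans ?_
      refine mul_le_mul_of_nonneg_left ?_ hr
      simp only [trace_add_one_pow]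
      rw [integral_finsetSum _ fun j _ =>
        (integrable_trace_gramSum_pow hY hY1 (S.erase k) j).const_mul _, Finset.mul_sum]
      refine Finset.sum_le_sum fun j hj => ?_
      rw [integral_const_mul, mul_left_comm]
      refine mul_le_mul_of_nonneg_left ?_ (Nat.cast_nonneg _)
      refine (ih j (Finset.mem_range.mp hj) (S.erase k)).trans ?_
      refine mul_le_mul_of_nonneg_left ?_ (Nat.cast_nonneg _)
      -- Removing `k` lowers the Poisson mean; monotonicity restores the mean of `S`, so the
      -- recursion closes.
      refine poissonMoment_mono j (by positivity) ?_
      refine mul_le_mul_of_nonneg_right ?_ hr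
      exact_mod_cast Finset.card_le_card (Finset.erase_subset k S)
    have hint : ∀ k ∈ S, Integrable (fun ω =>
        (outer (Y k ω) * (gramSum (fun l => Y l ω) (S.erase k) + 1) ^ p).trace) μ := by
      intro k _
      refine (memLp_top_trace (memLp_top_mul_apply (memLp_top_outer_apply (hY k) (hY1 k))
        (memLp_top_pow_apply (fun i j => ?_) p))).integrable le_top
      exact (memLp_top_gramSum_apply hY hY1 _ i j).add (memLp_const ((1 : Matrix _ _ ℝ) i j))
    have hall : ∀ᵐ ω ∂μ, ∀ k ∈ S, ‖Y k ω‖ ≤ 1 :=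
      (Filter.eventually_all_finset S).mpr fun k _ => hY1 k
    calc ∫ ω, (gramSum (fun k => Y k ω) S ^ (p + 1)).trace ∂μ
        ≤ ∫ ω, ∑ k ∈ S,
            (outer (Y k ω) * (gramSum (fun l => Y l ω) (S.erase k) + 1) ^ p).trace ∂μ := by
          refine integral_mono_ae (integrable_trace_gramSum_pow hY hY1 S (p + 1))
            (integrable_finsetSum _ hint) ?_
          filter_upwards [hall] with ω hω
          exact trace_gramSum_pow_succ_le (fun k => Y k ω) S hω p
      _ ≤ ∑ k ∈ S, r * (d * ∑ j ∈ Finset.range (p + 1), (p.choose j : ℝ) * poissonMoment j x) := by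
          rw [integral_finsetSum _ hint]
          exact Finset.sum_le_sum hstep
      _ = d * poissonMoment (p + 1) x := by
          rw [Finset.sum_const, nsmul_eq_mul, poissonMoment_succ p hx]
          ring

end Random
end SampledGram

/-! ### From trace moments to exponential moments of the norm, and back to its first two moments. -/

namespace SampledGram

open Matrix Filter Topology
open scoped Matrix.Norms.L2Operator Nat

section Norm

variable {d : ℕ} {ι : Type*} {P : Measure (EuclideanSpace ℝ (Fin d))}
  {Ω : Type*} [MeasurableSpace Ω] {μ : Measure Ω}
  {Y : ι → Ω → EuclideanSpace ℝ (Fin d)}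

theorem aestronglyMeasurable_norm_gramSum (hY : ∀ k, AEMeasurable (Y k) μ) (S : Finset ι) :
    AEStronglyMeasurable (fun ω => ‖gramSum (fun k => Y k ω) S‖) μ := by
  have h : Continuous fun y : S → EuclideanSpace ℝ (Fin d) => ‖gramSum y Finset.univ‖ := by
    refine Continuous.norm (continuous_finsetSum _ fun k _ => continuous_matrix fun a b => ?_)
    simp only [outer, of_apply]
    fun_prop
  have h2 : AEMeasurable (fun ω => fun k : S => Y k ω) μ := aemeasurable_pi_lambda _ fun k => hY k
  refine (h.measurable.comp_aemeasurable h2).aestronglyMeasurable.congr (ae_of_all _ fun ω => ?_)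
  simp only [Function.comp_apply]
  rw [gramSum_univ_subtype (fun l => Y l ω)]

theorem norm_outer_le {y : EuclideanSpace ℝ (Fin d)} (hy : ‖y‖ ≤ 1) : ‖outer y‖ ≤ 1 := by
  rcases isEmpty_or_nonempty (Fin d) with h | h
  · rw [Subsingleton.elim (outer y) 0, norm_zero]
    exact zero_le_one
  have h1 := norm_pow_le_trace_pow (posSemidef_outer y) 1
  rw [pow_one, pow_one] at h1
  refine h1.trans ?_
  rw [outer_eq_vecMulVec, trace_vecMulVec]
  have h2 := EuclideanSpace.real_norm_sq_eq y
  calc y.ofLp ⬝ᵥ y.ofLp = ‖y‖ ^ 2 := by rw [h2, dotProduct]; simp [sq]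
    _ ≤ 1 := pow_le_one₀ (norm_nonneg _) hy

theorem norm_gramSum_le {y : ι → EuclideanSpace ℝ (Fin d)} {S : Finset ι}
    (hy : ∀ k ∈ S, ‖y k‖ ≤ 1) : ‖gramSum y S‖ ≤ S.card := by
  refine (norm_sum_le _ _).trans ?_
  refine (Finset.sum_le_card_nsmul S _ 1 fun k hk => norm_outer_le (hy k hk)).trans_eq ?_
  simp

theorem ae_norm_gramSum_le (hY1 : ∀ k, ∀ᵐ ω ∂μ, ‖Y k ω‖ ≤ 1) (S : Finset ι) :
    ∀ᵐ ω ∂μ, ‖gramSum (fun k => Y k ω) S‖ ≤ S.card := by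
  filter_upwards [(Filter.eventually_all_finset S).mpr fun k _ => hY1 k] with ω hω
  exact norm_gramSum_le hω

variable [IsProbabilityMeasure μ]

theorem integrable_comp_norm_gramSum (hY : ∀ k, AEMeasurable (Y k) μ)
    (hY1 : ∀ k, ∀ᵐ ω ∂μ, ‖Y k ω‖ ≤ 1) (S : Finset ι) {f : ℝ → ℝ} (hf : Continuous f)
    (hmono : MonotoneOn f (Set.Ici 0)) (hf0 : 0 ≤ f 0) :
    Integrable (fun ω => f ‖gramSum (fun k => Y k ω) S‖) μ := by
  refine (memLp_top_of_bound (hf.comp_aestronglyMeasurable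
    (aestronglyMeasurable_norm_gramSum hY S)) (f S.card) ?_).integrable le_top
  filter_upwards [ae_norm_gramSum_le hY1 S] with ω hω
  have h0 : (0 : ℝ) ≤ ‖gramSum (fun k => Y k ω) S‖ := norm_nonneg _
  rw [Real.norm_of_nonneg (hf0.trans (hmono Set.self_mem_Ici h0 h0))]
  exact hmono h0 (h0.trans hω) hω

theorem integrable_norm_gramSum_pow (hY : ∀ k, AEMeasurable (Y k) μ)
    (hY1 : ∀ k, ∀ᵐ ω ∂μ, ‖Y k ω‖ ≤ 1) (S : Finset ι) (p : ℕ) :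
    Integrable (fun ω => ‖gramSum (fun k => Y k ω) S‖ ^ p) μ :=
  integrable_comp_norm_gramSum hY hY1 S (f := fun t => t ^ p) (continuous_pow p)
    (fun _ ha _ _ hab => pow_le_pow_left₀ ha hab p) (pow_nonneg le_rfl p)

theorem integrable_exp_norm_gramSum (hY : ∀ k, AEMeasurable (Y k) μ)
    (hY1 : ∀ k, ∀ᵐ ω ∂μ, ‖Y k ω‖ ≤ 1) (S : Finset ι) :
    Integrable (fun ω => Real.exp ‖gramSum (fun k => Y k ω) S‖) μ :=
  integrable_comp_norm_gramSum hY hY1 S Real.continuous_exp (Real.exp_monotone.monotoneOn _)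
    (Real.exp_pos 0).le

theorem integral_norm_gramSum_pow_le [Nonempty (Fin d)] (hindep : iIndepFun Y μ)
    (hlaw : ∀ k, HasLaw (Y k) P μ) (hY1 : ∀ k, ∀ᵐ ω ∂μ, ‖Y k ω‖ ≤ 1) (S : Finset ι) (p : ℕ) :
    ∫ ω, ‖gramSum (fun k => Y k ω) S‖ ^ p ∂μ
      ≤ d * poissonMoment p (S.card * ‖secondMoment P‖) := by
  have hY := fun k => (hlaw k).aemeasurable
  refine (integral_mono (integrable_norm_gramSum_pow hY hY1 S p)
    (integrable_trace_gramSum_pow hY hY1 S p) fun ω => ?_).trans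
    (integral_trace_gramSum_pow_le hindep hlaw hY1 S p)
  exact norm_pow_le_trace_pow (posSemidef_gramSum _ S) p

/-- A matrix Chernoff bound for the exponential moment of the norm. -/
theorem integral_exp_norm_gramSum_le [Nonempty (Fin d)] (hindep : iIndepFun Y μ)
    (hlaw : ∀ k, HasLaw (Y k) P μ) (hY1 : ∀ k, ∀ᵐ ω ∂μ, ‖Y k ω‖ ≤ 1) (S : Finset ι) :
    ∫ ω, Real.exp ‖gramSum (fun k => Y k ω) S‖ ∂μ
      ≤ d * Real.exp ((Real.exp 1 - 1) * (S.card * ‖secondMoment P‖)) := by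
  have hY := fun k => (hlaw k).aemeasurable
  have hint : ∀ N, ∀ p ∈ Finset.range N,
      Integrable (fun ω => ‖gramSum (fun k => Y k ω) S‖ ^ p / p !) μ := fun N p _ =>
    (integrable_norm_gramSum_pow hY hY1 S p).div_const _
  -- The Taylor polynomials of `exp` at a nonnegative point are dominated by `exp` itself, which is
  -- integrable here because the norm is almost surely at most `S.card`.
  have hlim : Tendsto (fun N : ℕ => ∫ ω, ∑ p ∈ Finset.range N,
      ‖gramSum (fun k => Y k ω) S‖ ^ p / (p ! : ℝ) ∂μ) atTop
      (𝓝 (∫ ω, Real.exp ‖gramSum (fun k => Y k ω) S‖ ∂μ)) := by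
    refine tendsto_integral_of_dominated_convergence _
      (fun N => (integrable_finsetSum _ (hint N)).aestronglyMeasurable)
      (integrable_exp_norm_gramSum hY hY1 S) (fun N => ae_of_all _ fun ω => ?_)
      (ae_of_all _ fun ω => ?_)
    · rw [Real.norm_of_nonneg (Finset.sum_nonneg fun p _ => by positivity)]
      exact Real.sum_le_exp_of_nonneg (norm_nonneg _) N
    · have h := NormedSpace.expSeries_div_hasSum_exp (‖gramSum (fun k => Y k ω) S‖ : ℝ)
      rw [← congrFun Real.exp_eq_exp_ℝ] at h
      exact h.tendsto_sum_nat
  refine le_of_tendsto' hlim fun N => ?_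
  rw [integral_finsetSum _ (hint N)]
  refine le_trans ?_ (mul_le_mul_of_nonneg_left
    (sum_poissonMoment_div_factorial_le N (x := S.card * ‖secondMoment P‖) (by positivity))
    (Nat.cast_nonneg d))
  rw [Finset.mul_sum]
  refine Finset.sum_le_sum fun p _ => ?_
  rw [integral_div, ← mul_div_assoc]
  exact div_le_div_of_nonneg_right (integral_norm_gramSum_pow_le hindep hlaw hY1 S p)
    (Nat.cast_nonneg _)

end Norm

section ExponentialMoment

variable {Ω : Type*} [MeasurableSpace Ω] {μ : Measure Ω} {X : Ω → ℝ}
  {a : ℝ}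

theorem integral_exp_sub_le_one (h : ∫ ω, Real.exp (X ω) ∂μ ≤ Real.exp a) :
    ∫ ω, Real.exp (X ω - a) ∂μ ≤ 1 := by
  simp only [Real.exp_sub]
  rw [integral_div]
  exact div_le_one_of_le₀ h (Real.exp_pos a).le

theorem integrable_exp_sub (h : Integrable (fun ω => Real.exp (X ω)) μ) :
    Integrable (fun ω => Real.exp (X ω - a)) μ := by
  simp only [Real.exp_sub]
  exact h.div_const _

variable [IsProbabilityMeasure μ]

/-- Jensen's inequality, through the tangent line of `exp` at `a`. -/
theorem integral_le_of_integral_exp_le (hX : Integrable X μ)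
    (hexp : Integrable (fun ω => Real.exp (X ω)) μ)
    (h : ∫ ω, Real.exp (X ω) ∂μ ≤ Real.exp a) : ∫ ω, X ω ∂μ ≤ a := by
  have h1 : ∫ ω, X ω ∂μ ≤ ∫ ω, ((a - 1) + Real.exp (X ω - a)) ∂μ :=
    integral_mono hX ((integrable_const _).add (integrable_exp_sub hexp)) fun ω => by
      linarith [Real.add_one_le_exp (X ω - a)]
  rw [integral_add (integrable_const _) (integrable_exp_sub hexp)] at h1
  have := integral_exp_sub_le_one h
  simp only [integral_const, probReal_univ, one_smul] at h1
  linarith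

theorem integral_sq_le_of_integral_exp_le (hX0 : ∀ ω, 0 ≤ X ω) (ha : 0 ≤ a)
    (hX : Integrable (fun ω => X ω ^ 2) μ) (hexp : Integrable (fun ω => Real.exp (X ω)) μ)
    (h : ∫ ω, Real.exp (X ω) ∂μ ≤ Real.exp a) : ∫ ω, X ω ^ 2 ∂μ ≤ a ^ 2 + (2 * a + 2) := by
  -- Above `a`, put `t = X - a`: then `(a + t)² = a² + 2at + t²` is dominated using `exp t ≥ 1 + t +
  -- t²/2`.
  have hle : ∀ ω, X ω ^ 2 ≤ a ^ 2 + (2 * a + 2) * Real.exp (X ω - a) := by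
    intro ω
    rcases le_total (X ω) a with hxa | hxa
    · have h1 : X ω ^ 2 ≤ a ^ 2 := pow_le_pow_left₀ (hX0 ω) hxa 2
      have h2 : 0 ≤ (2 * a + 2) * Real.exp (X ω - a) := by positivity
      linarith
    · have h1 := Real.quadratic_le_exp_of_nonneg (sub_nonneg.mpr hxa)
      have h2 : 0 ≤ X ω - a := sub_nonneg.mpr hxa
      nlinarith [mul_nonneg ha h2, mul_le_mul_of_nonneg_left h1 (by linarith : 0 ≤ 2 * a + 2),
        mul_nonneg ha (sq_nonneg (X ω - a))]
  have h1 := integral_mono hX ((integrable_const (a ^ 2)).add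
    ((integrable_exp_sub (a := a) hexp).const_mul (2 * a + 2))) hle
  have h2 := integral_exp_sub_le_one h
  simp only [Pi.add_apply] at h1
  rw [integral_add (integrable_const _) ((integrable_exp_sub hexp).const_mul _),
    integral_const_mul] at h1
  simp only [integral_const, probReal_univ, one_smul] at h1
  have := mul_le_mul_of_nonneg_left h2 (by linarith : 0 ≤ 2 * a + 2)
  linarith

end ExponentialMoment

/-- Numerically, `3/4 + (e - 1) < 5/2`. -/
theorem mul_exp_le_exp {d : ℕ} (hd : 0 < d) {x : ℝ} (hx : 0 ≤ x)
    (hdx : Real.log d ≤ 3 / 4 * x) :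
    (d : ℝ) * Real.exp ((Real.exp 1 - 1) * x) ≤ Real.exp (5 / 2 * x) := by
  have h1 : (d : ℝ) = Real.exp (Real.log d) := (Real.exp_log (by exact_mod_cast hd)).symm
  rw [h1, ← Real.exp_add, Real.exp_le_exp]
  nlinarith [Real.exp_one_lt_d9]

theorem poissonMoment_zero_right {p : ℕ} (hp : p ≠ 0) : poissonMoment p 0 = 0 := by
  obtain ⟨q, rfl⟩ := Nat.exists_eq_succ_of_ne_zero hp
  rw [poissonMoment_succ q le_rfl, zero_mul]

end SampledGram

/-! ### The two moment bounds. -/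

open SampledGram in
theorem theorem2p1 {d K : ℕ}
    (P : Measure (EuclideanSpace ℝ (Fin d))) [IsProbabilityMeasure P]
    (hP : ∀ᵐ y ∂P, ‖y‖ ≤ 1)
    (ρ : ℝ) (hρ : ρ ^ 2 = SampledGram.sigmaOne (SampledGram.secondMoment P))
    {Ω : Type*} [MeasurableSpace Ω] (μ : Measure Ω) [IsProbabilityMeasure μ]
    (Y : Fin K → Ω → EuclideanSpace ℝ (Fin d))
    (hindep : iIndepFun Y μ) (hlaw : ∀ k, HasLaw (Y k) P μ) :
    ((K : ℝ) > 4 / (3 * ρ ^ 2) * Real.log d →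
      Integrable (fun ω => SampledGram.sigmaOne (SampledGram.sampleMatrix Y ω) / K) μ ∧
      ∫ ω, SampledGram.sigmaOne (SampledGram.sampleMatrix Y ω) / K ∂μ ≤ 5 * ρ ^ 2) ∧
    ((K : ℝ) > max (4 / (3 * ρ ^ 2) * Real.log d) (8 * √2 / (3 * ρ ^ 2) * √d) →
      Integrable (fun ω => SampledGram.sigmaOne (SampledGram.sampleMatrix Y ω) ^ 2 / (K : ℝ) ^ 2) μ ∧
      ∫ ω, SampledGram.sigmaOne (SampledGram.sampleMatrix Y ω) ^ 2 / (K : ℝ) ^ 2 ∂μ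
        ≤ 14 * ρ ^ 4) := by
  open scoped Matrix.Norms.L2Operator in
  have hY := fun k => (hlaw k).aemeasurable
  have hY1 : ∀ k, ∀ᵐ ω ∂μ, ‖Y k ω‖ ≤ 1 := fun k =>
    ae_of_ae_map (hY k) (by rw [(hlaw k).map_eq]; exact hP)
  set X : Ω → ℝ := fun ω => ‖gramSum (fun k => Y k ω) Finset.univ‖
  have hsig : ∀ ω, sigmaOne (sampleMatrix Y ω) = X ω := fun ω => sigmaOne_eq_norm _
  rw [sigmaOne_eq_norm] at hρ
  simp only [hsig]
  have hX0 : ∀ ω, 0 ≤ X ω := fun ω => norm_nonneg _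
  have hX2 : Integrable (fun ω => X ω ^ 2) μ := integrable_norm_gramSum_pow hY hY1 _ 2
  have hX1 : Integrable X μ := by simpa using integrable_norm_gramSum_pow hY hY1 Finset.univ 1
  have hXe : Integrable (fun ω => Real.exp (X ω)) μ := integrable_exp_norm_gramSum hY hY1 _
  rcases Nat.eq_zero_or_pos d with rfl | hd
  -- Dimension zero is separate: the empty trace does not dominate the zeroth power of the norm.
  · have hX : ∀ ω, X ω = 0 := fun ω => by
      simp only [X]
      rw [Subsingleton.elim (gramSum _ _) 0, norm_zero]
    simp only [hX]
    refine ⟨fun _ => ⟨by simp, ?_⟩, fun _ => ⟨by simp, ?_⟩⟩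
    · simp; positivity
    · simp; positivity
  have : Nonempty (Fin d) := ⟨⟨0, hd⟩⟩
  have hmom : ∀ p, ∫ ω, X ω ^ p ∂μ ≤ d * poissonMoment p (K * ρ ^ 2) := fun p => by
    simpa [hρ] using integral_norm_gramSum_pow_le hindep hlaw hY1 Finset.univ p
  have hexp : ∫ ω, Real.exp (X ω) ∂μ ≤ d * Real.exp ((Real.exp 1 - 1) * (K * ρ ^ 2)) := by
    simpa [hρ] using integral_exp_norm_gramSum_le hindep hlaw hY1 Finset.univ
  have hlog : 0 ≤ Real.log d := Real.log_natCast_nonneg d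
  rw [integral_div, integral_div]
  -- For `ρ = 0` the Poisson mean is zero, so the bounds on both moments vanish.
  rcases eq_or_ne ρ 0 with rfl | hρ0
  · have h1 := hmom 1
    have h2 := hmom 2
    simp only [ne_eq, OfNat.ofNat_ne_zero, not_false_eq_true, zero_pow, mul_zero,
      poissonMoment_zero_right one_ne_zero, poissonMoment_zero_right two_ne_zero, pow_one]
      at h1 h2
    refine ⟨fun _ => ⟨hX1.div_const _, ?_⟩, fun _ => ⟨hX2.div_const _, ?_⟩⟩
    · simpa using div_nonpos_of_nonpos_of_nonneg h1 (Nat.cast_nonneg K)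
    · simpa using div_nonpos_of_nonpos_of_nonneg h2 (sq_nonneg (K : ℝ))
  have hρ2 : 0 < ρ ^ 2 := by positivity
  have hlogK : (K : ℝ) > 4 / (3 * ρ ^ 2) * Real.log d →
      0 < (K : ℝ) ∧ ∫ ω, Real.exp (X ω) ∂μ ≤ Real.exp (5 / 2 * (K * ρ ^ 2)) := by
    intro hK
    refine ⟨lt_of_le_of_lt (by positivity) hK, hexp.trans (mul_exp_le_exp hd (by positivity) ?_)⟩
    rw [gt_iff_lt, div_mul_eq_mul_div, div_lt_iff₀ (by positivity)] at hK
    linarith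
  refine ⟨fun hK => ⟨hX1.div_const _, ?_⟩, fun hK => ⟨hX2.div_const _, ?_⟩⟩
  · obtain ⟨hK0, hE⟩ := hlogK hK
    rw [div_le_iff₀ hK0]
    refine (integral_le_of_integral_exp_le hX1 hXe hE).trans ?_
    nlinarith [mul_pos hK0 hρ2]
  · obtain ⟨hK0, hE⟩ := hlogK ((le_max_left _ _).trans_lt hK)
    -- The second lower bound on `K` gives `Kρ² > (8/3)√2 √d ≥ 8/3`.
    have hx : 2 ≤ K * ρ ^ 2 := by
      have h1 := (le_max_right _ _).trans_lt hK
      rw [div_mul_eq_mul_div, div_lt_iff₀ (by positivity)] at h1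
      have h2 : 1 ≤ √2 := Real.one_le_sqrt.mpr one_le_two
      have h3 : 1 ≤ √(d : ℝ) := Real.one_le_sqrt.mpr (by exact_mod_cast hd)
      nlinarith
    rw [div_le_iff₀ (by positivity)]
    -- With `x = Kρ²` it remains that `(25/4)x² + 5x + 2 ≤ 14x²`, which holds for `x ≥ 2`.
    refine (integral_sq_le_of_integral_exp_le hX0 (by positivity) hX2 hXe hE).trans ?_
    nlinarith
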